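/- Let $k\in\tfrac12+\mathbb Z$ be a half-integer and let $h$ be a nonzero integer. For odd $d$ put $\varepsilon_d=1$ if $d\equiv1\bmod 4$ and $\varepsilon_d=i$ if $d\equiv3\bmod4$, write $e(x)=e^{2\pi i x}$, let $\left(\frac{\cdot}{\cdot}\right)$ be the Kronecker symbol, and for $c\ge1$ define the Gauss sum $$g_h(4c)=\sum_{d\bmod 4c}\varepsilon_d^{2k}\left(\frac{4c}{d}\right)e\!\left(\frac{hd}{4c}\right)$$ (only odd $d$ contribute). Let $\chi_{k,h}$ be the quadratic Dirichlet character $n\mapsto\left(\frac{(-1)^{k-1/2}h}{n}\right)$ modulo $4|h|$. For a Dirichlet character $\chi$ and $Q\ge1$ let $L^{(Q)}(s,\chi)$ and $\zeta^{(Q)}(s)$ denote $L(s,\chi)$ and $\zeta(s)$ with the Euler factors at the primes dividing $Q$ removed, where $\zeta^{(2h)}$ means $\zeta^{(2|h|)}$. Then there is a finite Dirichlet polynomial $\widetilde D_\infty^k(h,w)=\sum_{n\ge 1}a(n)n^{-2w}$, with finitely many nonzero coefficients $a(n)\in\mathbb C$ depending only on $k$ and $h$, such that for all $w\in\mathbb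 C$ with $\operatorname{Re}w>\tfrac34$ the series on the left converges absolutely and $$\sum_{c\ge1}\frac{g_h(4c)}{(4c)^{2w}}=\frac{L^{(2)}(2w-\tfrac12,\chi_{k,h})}{\zeta^{(2h)}(4w-1)}\,\widetilde D_\infty^k(h,w).$$ The same holds, with a possibly different finite Dirichlet polynomial, if $\chi_{k,h}$ is taken to be the primitive quadratic character attached to the extension $\mathbb Q\big(\sqrt{(-1)^{k-1/2}h}\big)/\mathbb Q$, i.e. the primitive character that induces the one above (the trivial character if $(-1)^{k-1/2}h$ is a square). -/

import Mathlib

/-- The Kronecker symbol `(a / n)` for an integer `a` and a natural number `n`: it is completely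
multiplicative in `n`, the Jacobi symbol for odd `n`, `(a / 2) = χ₈(a)` (that is `0` for even `a`,
`1` for `a ≡ ±1 mod 8`, `-1` for `a ≡ ±3 mod 8`), and `(a / 0)` is `1` if `a = ±1` and `0`
otherwise. -/
def kroneckerSym (a : ℤ) (n : ℕ) : ℤ :=
  if n = 0 then (if a.natAbs = 1 then 1 else 0)
  else ZMod.χ₈ (a : ZMod 8) ^ n.factorization 2 * jacobiSym a (n / 2 ^ n.factorization 2)

/-- On odd `n` the Kronecker symbol is the Jacobi symbol. -/
theorem kroneckerSym_odd (a : ℤ) {n : ℕ} (hn : Odd n) : kroneckerSym a n = jacobiSym a n := by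
  have h2 : ¬ 2 ∣ n := by
    rw [Nat.two_dvd_ne_zero]
    exact Nat.odd_iff.mp hn
  have h0 : n ≠ 0 := by
    rintro rfl
    exact h2 (dvd_zero 2)
  rw [kroneckerSym, if_neg h0, Nat.factorization_eq_zero_of_not_dvd h2]
  simp

/-- The sign `ε_d` of the quadratic Gauss sum: `1` if `d ≡ 1 mod 4` and `i` if `d ≡ 3 mod 4`.
Even `d` never contribute; the value there is set to `0`. -/
noncomputable def epsSign (d : ℕ) : ℂ :=
  if d % 4 = 1 then 1 else if d % 4 = 3 then Complex.I else 0

/-- The Gauss sum `g_h(q) = ∑_{d mod q} ε_d^{2k} (q/d) e(hd/q)` of half-integral weight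
`k = m + 1/2`, so that `2k = 2m + 1`; here `e(x) = exp(2πix)`. -/
noncomputable def halfGaussSum (m h : ℤ) (q : ℕ) : ℂ :=
  ∑ d ∈ Finset.range q, epsSign d ^ (2 * m + 1) * (kroneckerSym (q : ℤ) d : ℂ) *
    Complex.exp (2 * Real.pi * Complex.I * ((h : ℂ) * (d : ℂ) / (q : ℂ)))

/-- The integer `(-1)^{k - 1/2} h` for the weight `k = m + 1/2`. -/
def twistedInt (m h : ℤ) : ℤ := (Int.negOnePow m : ℤ) * h

theorem natAbs_twistedInt (m h : ℤ) : (twistedInt m h).natAbs = h.natAbs := by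
  rw [twistedInt, Int.natAbs_mul]
  simp

/-- The quadratic Dirichlet character `n ↦ (a / n)` modulo `4|a|`, where `a ≠ 0`. -/
noncomputable def quadraticSymbolChar (a : ℤ) [NeZero a] :
    DirichletCharacter ℂ (4 * a.natAbs) where
  toFun x := open scoped Classical in if IsUnit x then (kroneckerSym a x.val : ℂ) else 0
  map_one' := by
    have h1 : 1 < 4 * a.natAbs := by
      have := Int.natAbs_pos.mpr (NeZero.ne a)
      omega
    haveI : Fact (1 < 4 * a.natAbs) := ⟨h1⟩
    rw [if_pos isUnit_one, ZMod.val_one, kroneckerSym_odd a odd_one, jacobiSym.one_right]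
    simp
  map_mul' x y := by
    have hodd : ∀ z : ZMod (4 * a.natAbs), IsUnit z → Odd z.val := by
      intro z hz
      have h := (ZMod.isUnit_iff_coprime z.val _).mp (by rwa [ZMod.natCast_zmod_val])
      have h' : Nat.Coprime z.val 2 := h.coprime_dvd_right ⟨2 * a.natAbs, by ring⟩
      exact Nat.coprime_two_right.mp h'
    by_cases hx : IsUnit x
    · by_cases hy : IsUnit y
      · have ox := hodd x hx
        have oy := hodd y hy
        haveI : NeZero x.val := ⟨ox.pos.ne'⟩
        haveI : NeZero y.val := ⟨oy.pos.ne'⟩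
        rw [if_pos (hx.mul hy), if_pos hx, if_pos hy, kroneckerSym_odd a (hodd _ (hx.mul hy)),
          kroneckerSym_odd a ox, kroneckerSym_odd a oy, ZMod.val_mul,
          ← jacobiSym.mod_right a (ox.mul oy), jacobiSym.mul_right]
        push_cast
        ring
      · rw [if_neg (fun h => hy (isUnit_of_mul_isUnit_right h)), if_neg hy, mul_zero]
    · rw [if_neg (fun h => hx (isUnit_of_mul_isUnit_left h)), if_neg hx, zero_mul]
  map_nonunit' x hx := if_neg hx

instance neZero_twistedInt (m h : ℤ) [NeZero h] : NeZero (twistedInt m h) :=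
  ⟨by
    intro h0
    have := natAbs_twistedInt m h
    rw [h0] at this
    exact NeZero.ne h (Int.natAbs_eq_zero.mp this.symm)⟩

instance neZero_conductor {N : ℕ} [NeZero N] (χ : DirichletCharacter ℂ N) : NeZero χ.conductor :=
  ⟨χ.conductor_ne_zero⟩

/-- The character `χ_{k,h} = ((-1)^{k - 1/2} h / ·)`, for `k = m + 1/2`, as a Dirichlet character
modulo `4|h|`. -/
noncomputable def chiSymbol (m h : ℤ) [NeZero h] :
    DirichletCharacter ℂ (4 * (twistedInt m h).natAbs) :=
  quadraticSymbolChar (twistedInt m h)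

/-- The primitive quadratic character attached to the extension `ℚ(√((-1)^{k - 1/2} h)) / ℚ`, for
`k = m + 1/2`: the primitive character inducing `((-1)^{k - 1/2} h / ·)`. -/
noncomputable def chiField (m h : ℤ) [NeZero h] : DirichletCharacter ℂ (chiSymbol m h).conductor :=
  (chiSymbol m h).primitiveCharacter

/-- `L^{(Q)}(s, χ)`: the Dirichlet `L`-function without its Euler factors at the primes dividing
`Q`. -/
noncomputable def partialLFunction {N : ℕ} [NeZero N] (Q : ℕ) (χ : DirichletCharacter ℂ N)
    (s : ℂ) : ℂ :=
  χ.LFunction s * ∏ p ∈ Q.primeFactors, (1 - χ (p : ZMod N) * (p : ℂ) ^ (-s))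

/-- `ζ^{(Q)}(s)`: the Riemann zeta function without its Euler factors at the primes dividing
`Q`. -/
noncomputable def partialZeta (Q : ℕ) (s : ℂ) : ℂ :=
  riemannZeta s * ∏ p ∈ Q.primeFactors, (1 - (p : ℂ) ^ (-s))

/-- The finite Dirichlet polynomial `∑ a(n) n^{-s}`, where `a(n) ≠ 0` for finitely many `n`. -/
noncomputable def dirichletPolynomial (a : ℕ+ →₀ ℂ) (s : ℂ) : ℂ :=
  a.sum fun n c => c * ((n : ℕ) : ℂ) ^ (-s)

/-! Three facts about `g_h(4c)` give the theorem. (1) Vanishing (`halfGaussSum_eq_zero`): if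
`p^(j+1) ∣ c` and `g_h(4c) ≠ 0`, then `p^j ∣ h`. Hence only `c = u * n` contribute, with `u ∣ 2h²`
and `n` squarefree and coprime to `2h` (`exists_eq_mul_of_halfGaussSum_ne_zero`). (2) Twisted
multiplicativity (`halfGaussSum_mul_squarefree`): for such `n`, `g_h(4un) = g_h(4u) χ_{k,h}(n) √n`.
This rests on the Chinese remainder theorem, quadratic reciprocity and the exact value `ε_p √p` of
the quadratic Gauss sum (`gaussSum_complexQuadraticChar`). The `ε` factors and the reciprocity sign
combine into the symbol `((-1)^(k-1/2) / p)`. (3) For a character with `χ² = 1`, the sum of `χ(n)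
n^(-s)` over squarefree `n` is `L(s, χ) / L(2s, χ²)` (`hasSum_squarefree`). At `s = 2w - 1/2` the
denominator is `ζ^(2h)(4w - 1)`. So the Dirichlet polynomial is the sum of `g_h(4u) (4u)^(-2w)` over
`u ∣ 2h²`. Passing to the primitive character only multiplies it by finitely many Euler factors.

The sign of the quadratic Gauss sum is found by Gauss's own method: an alternating sum of Gaussian
binomials at a root of unity turns the sum into a product of sines. -/

/-! ### Gaussian binomials and their alternating sum. -/

/-- The Gaussian binomial coefficient `[n, k]_x`, as a quotient of products. -/
noncomputable def gaussBinom (x : ℂ) (n k : ℕ) : ℂ :=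
  ∏ i ∈ Finset.range k, (1 - x ^ (n - i)) / (1 - x ^ (i + 1))

theorem gaussBinom_zero_right (x : ℂ) (n : ℕ) : gaussBinom x n 0 = 1 := by simp [gaussBinom]

theorem gaussBinom_succ_right (x : ℂ) (n k : ℕ) :
    gaussBinom x n (k + 1) = gaussBinom x n k * ((1 - x ^ (n - k)) / (1 - x ^ (k + 1))) :=
  Finset.prod_range_succ _ _

theorem gaussBinom_eq_zero (x : ℂ) {n k : ℕ} (h : n < k) : gaussBinom x n k = 0 :=
  Finset.prod_eq_zero (Finset.mem_range.mpr h) (by simp)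

theorem gaussBinom_succ_succ (x : ℂ) (n k : ℕ) (hx : ∀ i ≤ k, x ^ (i + 1) ≠ 1) :
    gaussBinom x (n + 1) (k + 1) * (1 - x ^ (k + 1)) = (1 - x ^ (n + 1)) * gaussBinom x n k := by
  have h : ∀ i ∈ Finset.range (k + 1), 1 - x ^ (i + 1) ≠ 0 := fun i hi =>
    sub_ne_zero.mpr (hx i (Finset.mem_range_succ_iff.mp hi)).symm
  have h' : ∀ i ∈ Finset.range k, 1 - x ^ (i + 1) ≠ 0 := fun i hi =>
    h i (Finset.mem_range.mpr ((Finset.mem_range.mp hi).trans (Nat.lt_succ_self k)))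
  have hk := h k (Finset.self_mem_range_succ k)
  have hP : ∏ i ∈ Finset.range k, (1 - x ^ (i + 1)) ≠ 0 := Finset.prod_ne_zero_iff.mpr h'
  rw [gaussBinom, gaussBinom, Finset.prod_div_distrib, Finset.prod_div_distrib,
    Finset.prod_range_succ' (fun i => 1 - x ^ (n + 1 - i)),
    Finset.prod_range_succ (fun i => 1 - x ^ (i + 1))]
  simp only [Nat.add_sub_add_right, Nat.sub_zero]
  field_simp

/-- The three-term recursion of the Rogers–Szegő polynomials, coefficientwise. -/
theorem gaussBinom_recursion (x : ℂ) (n k : ℕ) (hx : ∀ i ≤ k, x ^ (i + 1) ≠ 1) :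
    gaussBinom x (n + 2) (k + 1) = gaussBinom x (n + 1) (k + 1) + gaussBinom x (n + 1) k -
      (1 - x ^ (n + 1)) * gaussBinom x n k := by
  have hk : 1 - x ^ (k + 1) ≠ 0 := sub_ne_zero.mpr (hx k le_rfl).symm
  have h1 := gaussBinom_succ_succ x n k hx
  have h2 := gaussBinom_succ_succ x (n + 1) k hx
  have h3 := gaussBinom_succ_right x (n + 1) k
  have h4 : x ^ (k + 1) * (gaussBinom x (n + 1) k * (x ^ (n + 1 - k))) =
      x ^ (n + 2) * gaussBinom x (n + 1) k := by
    -- For `k > n + 1` the subtraction truncates, but the binomial itself is zero.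
    rcases le_or_gt k (n + 1) with h | h
    · rw [show n + 2 = (k + 1) + (n + 1 - k) by omega, pow_add]
      ring
    · rw [gaussBinom_eq_zero x h]
      ring
  have h5 : gaussBinom x (n + 1) (k + 1) * (1 - x ^ (k + 1)) =
      gaussBinom x (n + 1) k * (1 - x ^ (n + 1 - k)) := by
    rw [h3]
    field_simp
  apply mul_right_cancel₀ hk
  linear_combination h2 - (1 - x ^ (k + 1)) * h1 - x ^ (k + 1) * h5 + h4

/-- Gauss's evaluation of the alternating sum of Gaussian binomial coefficients. -/
theorem sum_gaussBinom (x : ℂ) (N : ℕ) (hx : ∀ i, i + 1 < N → x ^ (i + 1) ≠ 1) (n : ℕ)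
    (hn : 2 * n < N) :
    ∑ k ∈ Finset.range N, (-1) ^ k * gaussBinom x (2 * n) k =
      ∏ i ∈ Finset.range n, (1 - x ^ (2 * i + 1)) := by
  -- The range `N` stays fixed during the induction; the terms with `k > 2 * n` vanish.
  obtain ⟨M, rfl⟩ : ∃ M, N = M + 1 := ⟨N - 1, by omega⟩
  induction n with
  | zero =>
    rw [Finset.sum_range_succ']
    simp [gaussBinom_eq_zero, gaussBinom_zero_right]
  | succ n ih =>
    rw [Finset.prod_range_succ, ← ih (by omega), Finset.sum_range_succ', gaussBinom_zero_right,
      show 2 * (n + 1) = 2 * n + 2 by ring]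
    -- In the recursion, the two sums with upper index `2 * n + 1` cancel up to the boundary term `k
    -- = 0`, leaving the factor `1 - x ^ (2 * n + 1)`.
    have h1 : ∑ k ∈ Finset.range M, (-1 : ℂ) ^ (k + 1) * gaussBinom x (2 * n + 2) (k + 1) =
        ∑ k ∈ Finset.range M, (-1 : ℂ) ^ (k + 1) * gaussBinom x (2 * n + 1) (k + 1)
        - ∑ k ∈ Finset.range M, (-1 : ℂ) ^ k * gaussBinom x (2 * n + 1) k
        + (1 - x ^ (2 * n + 1)) * ∑ k ∈ Finset.range M, (-1 : ℂ) ^ k * gaussBinom x (2 * n) k := by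
      rw [Finset.mul_sum, ← Finset.sum_sub_distrib, ← Finset.sum_add_distrib]
      refine Finset.sum_congr rfl fun k hk => ?_
      rw [gaussBinom_recursion x (2 * n) k fun i hi =>
        hx i (by have := Finset.mem_range.mp hk; omega)]
      ring
    have h2 := Finset.sum_range_succ' (fun k => (-1 : ℂ) ^ k * gaussBinom x (2 * n + 1) k) M
    have h3 := Finset.sum_range_succ (fun k => (-1 : ℂ) ^ k * gaussBinom x (2 * n + 1) k) M
    have h4 := Finset.sum_range_succ (fun k => (-1 : ℂ) ^ k * gaussBinom x (2 * n) k) M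
    rw [gaussBinom_eq_zero x (show 2 * n + 1 < M by omega), mul_zero, add_zero] at h3
    rw [gaussBinom_eq_zero x (show 2 * n < M by omega), mul_zero, add_zero] at h4
    rw [h1, h4, ← h3, h2, gaussBinom_zero_right]
    ring

/-! ### The quadratic Gauss sum and its sign. -/

/-- The product formula for the quadratic Gauss sum of odd modulus. -/
theorem sum_pow_sq_add_self {ω : ℂ} {n : ℕ} (hω : IsPrimitiveRoot ω (2 * n + 1)) :
    ∑ k ∈ Finset.range (2 * n + 1), ω ^ (k ^ 2 + k) =
      ∏ i ∈ Finset.range n, (1 - (ω⁻¹) ^ (2 * (2 * i + 1))) := by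
  have hω0 : ω ≠ 0 := hω.ne_zero (by omega)
  have hζ : IsPrimitiveRoot ((ω⁻¹) ^ 2) (2 * n + 1) :=
    hω.inv.pow_of_coprime 2 (by simp)
  have hne : ∀ i, i + 1 < 2 * n + 1 → ((ω⁻¹) ^ 2) ^ (i + 1) ≠ 1 := fun i hi =>
    hζ.pow_ne_one_of_pos_of_lt (by omega) hi
  have h := sum_gaussBinom _ (2 * n + 1) hne n (by omega)
  simp only [← pow_mul] at h
  rw [← h]
  refine Finset.sum_congr rfl fun k hk => ?_
  -- With `x = ω⁻²` and `x ^ (2 * n + 1) = 1`, the new factor is `(1 - x^(-(j+1))) / (1 - x^(j+1)) =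
  -- -x^(-(j+1))`, that is `-ω^(2(j+1))`.
  have key : ∀ j, j < 2 * n + 1 →
      gaussBinom ((ω⁻¹) ^ 2) (2 * n) j = (-1) ^ j * ω ^ (j ^ 2 + j) := by
    intro j hj
    induction j with
    | zero => simp [gaussBinom]
    | succ j ih =>
      rw [gaussBinom_succ_right, ih (by omega)]
      have h1 : 1 - ((ω⁻¹) ^ 2) ^ (j + 1) ≠ 0 := sub_ne_zero.mpr (hne j hj).symm
      have h2 : ((ω⁻¹) ^ 2) ^ (2 * n - j) = ω ^ (2 * (j + 1)) := by
        have h3 := hζ.pow_eq_one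
        rw [show 2 * n + 1 = (2 * n - j) + (j + 1) by omega, pow_add] at h3
        rw [eq_comm, pow_mul, ← mul_left_inj' (pow_ne_zero (j + 1) (pow_ne_zero 2 (inv_ne_zero hω0))),
          h3, ← mul_pow, ← mul_pow, mul_inv_cancel₀ hω0, one_pow, one_pow]
      have h4 : (1 - ω ^ (2 * (j + 1))) / (1 - ((ω⁻¹) ^ 2) ^ (j + 1)) = - ω ^ (2 * (j + 1)) := by
        rw [div_eq_iff h1, ← pow_mul]
        have : ω ^ (2 * (j + 1)) * (ω⁻¹) ^ (2 * (j + 1)) = 1 := by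
          rw [← mul_pow, mul_inv_cancel₀ hω0, one_pow]
        linear_combination -this
      rw [h2, h4]
      ring
  rw [key k (Finset.mem_range.mp hk), ← mul_assoc, ← mul_pow]
  simp

theorem sum_range_zmod {N : ℕ} [NeZero N] (F : ZMod N → ℂ) :
    ∑ k ∈ Finset.range N, F (k : ZMod N) = ∑ x, F x :=
  Finset.sum_nbij' (fun k => (k : ZMod N)) ZMod.val (fun _ _ => Finset.mem_univ _)
    (fun x _ => Finset.mem_range.mpr (ZMod.val_lt x))
    (fun _ hk => ZMod.val_cast_of_lt (Finset.mem_range.mp hk)) (fun x _ => ZMod.natCast_zmod_val x)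
    fun _ _ => rfl

/-- The quadratic Gauss sum of odd modulus `N = 2n + 1` at the frequency `n + 1` is a positive
multiple of `(-i)^n`. -/
theorem exists_sum_stdAddChar_sq (n : ℕ) :
    ∃ R : ℝ, 0 < R ∧ ∑ x : ZMod (2 * n + 1), ZMod.stdAddChar ((n + 1 : ZMod (2 * n + 1)) * x ^ 2) =
      (-Complex.I) ^ n * R := by
  set ω : ℂ := ZMod.stdAddChar ((n + 1 : ℕ) : ZMod (2 * n + 1)) with hωdef
  have hψ (k : ℕ) : ZMod.stdAddChar ((n + 1 : ZMod (2 * n + 1)) * (k : ZMod (2 * n + 1))) = ω ^ k := by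
    rw [hωdef, ← AddChar.map_nsmul_eq_pow]
    congr 1
    push_cast
    rw [nsmul_eq_mul]
    ring
  have hexp : ω = -Complex.exp (Real.pi * Complex.I / (2 * n + 1 : ℝ)) := by
    have h := ZMod.stdAddChar_coe (N := 2 * n + 1) (n + 1 : ℕ)
    rw [Int.cast_natCast] at h
    rw [hωdef, h, ← mul_neg_one, ← Complex.exp_pi_mul_I, ← Complex.exp_add]
    congr 1
    have : (2 * n + 1 : ℂ) ≠ 0 := by exact_mod_cast (by omega : 2 * n + 1 ≠ 0)
    push_cast
    field_simp
    ring
  have hω : IsPrimitiveRoot ω (2 * n + 1) := by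
    have h1 := (Complex.isPrimitiveRoot_exp (2 * n + 1) (by omega)).pow_of_coprime (n + 1) (by
      rw [show 2 * n + 1 = (n + 1) + n by ring]
      simp)
    convert! h1 using 1
    have h := ZMod.stdAddChar_coe (N := 2 * n + 1) (n + 1 : ℕ)
    rw [Int.cast_natCast] at h
    rw [hωdef, h, ← Complex.exp_nat_mul]
    congr 1
    push_cast
    ring
  have hω0 : ω ≠ 0 := hω.ne_zero (by omega)
  have h2 : (2 * (n + 1) : ZMod (2 * n + 1)) = 1 := by
    have : ((2 * n + 1 : ℕ) : ZMod (2 * n + 1)) = 0 := ZMod.natCast_self _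
    push_cast at this
    linear_combination this
  -- Since `n + 1` is the inverse of `2`, the shift `x = k + (n + 1)` turns `x²` into `k² + k + (n +
  -- 1)²`.
  have hshift : ∑ x : ZMod (2 * n + 1), ZMod.stdAddChar ((n + 1 : ZMod (2 * n + 1)) * x ^ 2) =
      ω ^ ((n + 1) ^ 2) * ∑ k ∈ Finset.range (2 * n + 1), ω ^ (k ^ 2 + k) := by
    rw [← Equiv.sum_comp (Equiv.addRight (n + 1 : ZMod (2 * n + 1))), ← sum_range_zmod,
      Finset.mul_sum]
    refine Finset.sum_congr rfl fun k _ => ?_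
    rw [← pow_add, ← hψ]
    congr 1
    simp only [Equiv.coe_addRight]
    push_cast
    linear_combination (n + 1 : ZMod (2 * n + 1)) * k * h2
  -- One power `ω ^ (2 * i + 1)` goes to each factor of the product formula, making it `ω^e - ω^(-e)
  -- = -2i sin θ` with `e = 2i + 1` and `θ = eπ/(2n+1)` in `(0, π)`.
  have hodd : ω ^ ((n + 1) ^ 2) = ∏ i ∈ Finset.range n, ω ^ (2 * i + 1) := by
    have h1 : ∏ i ∈ Finset.range n, ω ^ (2 * i + 1) = ω ^ (n ^ 2) := by
      clear_value ω
      clear hψ hexp hω h2 hshift hωdef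
      induction n with
      | zero => simp
      | succ n ih =>
        rw [Finset.prod_range_succ, ih, ← pow_add]
        congr 1
        ring
    rw [h1, show (n + 1) ^ 2 = n ^ 2 + (2 * n + 1) by ring, pow_add, hω.pow_eq_one, mul_one]
  refine ⟨∏ i ∈ Finset.range n, (2 * Real.sin ((2 * i + 1) * Real.pi / (2 * n + 1))),
    Finset.prod_pos fun i hi => ?_, ?_⟩
  · have hi := Finset.mem_range.mp hi
    have hi' : (i : ℝ) + 1 ≤ n := by exact_mod_cast hi
    have hn : (0 : ℝ) < 2 * n + 1 := by positivity
    refine mul_pos two_pos (Real.sin_pos_of_pos_of_lt_pi (by positivity) ?_)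
    rw [div_lt_iff₀ hn]
    nlinarith [Real.pi_pos]
  · rw [hshift, sum_pow_sq_add_self hω, hodd, ← Finset.prod_mul_distrib, Complex.ofReal_prod,
      show (-Complex.I) ^ n = ∏ _i ∈ Finset.range n, -Complex.I by simp,
      ← Finset.prod_mul_distrib]
    refine Finset.prod_congr rfl fun i _ => ?_
    have h3 : ω ^ (2 * i + 1) * (ω⁻¹) ^ (2 * (2 * i + 1)) = (ω ^ (2 * i + 1))⁻¹ := by
      generalize 2 * i + 1 = e
      rw [two_mul, pow_add, ← mul_assoc, ← mul_pow, mul_inv_cancel₀ hω0, one_pow,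
        one_mul, inv_pow]
    have hθ : ω ^ (2 * i + 1) =
        -Complex.exp (((2 * i + 1) * Real.pi / (2 * n + 1) : ℝ) * Complex.I) := by
      rw [hexp, Odd.neg_pow ⟨i, rfl⟩, ← Complex.exp_nat_mul]
      congr 2
      push_cast
      ring
    rw [mul_sub, mul_one, h3, hθ, inv_neg, ← Complex.exp_neg]
    push_cast
    rw [Complex.sin, neg_mul ((2 * i + 1 : ℂ) * Real.pi / (2 * n + 1))]
    linear_combination (Complex.exp (-((2 * i + 1) * Real.pi / (2 * n + 1) * Complex.I))
      - Complex.exp ((2 * i + 1) * Real.pi / (2 * n + 1) * Complex.I)) * Complex.I_sq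

/-- The quadratic character of `ℤ / p`, with complex values. -/
noncomputable def complexQuadraticChar (p : ℕ) [Fact p.Prime] : MulChar (ZMod p) ℂ :=
  (quadraticChar (ZMod p)).ringHomComp (Int.castRingHom ℂ)

theorem complexQuadraticChar_intCast (p : ℕ) [Fact p.Prime] (a : ℤ) :
    complexQuadraticChar p (a : ZMod p) = (jacobiSym a p : ℂ) := by
  rw [← jacobiSym.legendreSym.to_jacobiSym]
  rfl

theorem ringChar_zmod_ne_two {p : ℕ} (h2 : p ≠ 2) : ringChar (ZMod p) ≠ 2 := by
  rwa [ZMod.ringChar_zmod_n]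

/-- Each `d` has `1 + χ(d)` square roots, and the part coming from `1` sums to zero because `a ≠ 0`.
-/
theorem sum_stdAddChar_mul_sq (p : ℕ) [Fact p.Prime] (h2 : p ≠ 2) {a : ZMod p} (ha : a ≠ 0) :
    ∑ x : ZMod p, ZMod.stdAddChar (a * x ^ 2) =
      complexQuadraticChar p a * gaussSum (complexQuadraticChar p) ZMod.stdAddChar := by
  have hχ : (complexQuadraticChar p).IsQuadratic :=
    (quadraticChar_isQuadratic (ZMod p)).comp _
  rw [← Finset.sum_fiberwise' Finset.univ (fun x : ZMod p => x ^ 2)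
    (fun d => (ZMod.stdAddChar (a * d) : ℂ))]
  have h : ∀ d : ZMod p, ∑ i : ZMod p with i ^ 2 = d, (ZMod.stdAddChar (a * d) : ℂ) =
      complexQuadraticChar p d * ZMod.stdAddChar (a * d) + ZMod.stdAddChar (d * a) := by
    intro d
    have hcard := quadraticChar_card_sqrts (ringChar_zmod_ne_two h2) d
    rw [Finset.sum_const, nsmul_eq_mul, mul_comm d a, ← add_one_mul]
    congr 1
    have : (Finset.univ.filter fun i : ZMod p => i ^ 2 = d) = {x : ZMod p | x ^ 2 = d}.toFinset := by
      ext; simp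
    rw [this]
    have := congrArg (Int.cast : ℤ → ℂ) hcard
    push_cast at this
    exact this
  rw [Finset.sum_congr rfl fun d _ => h d, Finset.sum_add_distrib,
    AddChar.sum_mulShift a (ZMod.isPrimitive_stdAddChar p), if_neg ha]
  have h3 := gaussSum_mulShift_eq (complexQuadraticChar p) ZMod.stdAddChar (Units.mk0 a ha)
  rw [hχ.inv, Units.val_mk0] at h3
  rw [← h3]
  simp [gaussSum]

/-- Gauss's theorem on the sign of the quadratic Gauss sum. -/
theorem gaussSum_complexQuadraticChar (p : ℕ) [Fact p.Prime] (h2 : p ≠ 2) :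
    gaussSum (complexQuadraticChar p) ZMod.stdAddChar = epsSign p * (Real.sqrt p : ℂ) := by
  have hp : p.Prime := Fact.out
  set G := gaussSum (complexQuadraticChar p) ZMod.stdAddChar with hG
  have hχ : (complexQuadraticChar p).IsQuadratic :=
    (quadraticChar_isQuadratic (ZMod p)).comp _
  have hχ1 : complexQuadraticChar p ≠ 1 :=
    (MulChar.ringHomComp_ne_one_iff (RingHom.injective_int _)).mpr
      (quadraticChar_ne_one (ringChar_zmod_ne_two h2))
  have hsq := gaussSum_sq hχ1 hχ (ZMod.isPrimitive_stdAddChar p)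
  rw [← hG] at hsq
  obtain ⟨n, hn⟩ := hp.odd_of_ne_two h2
  obtain ⟨R, hR, hsum⟩ : ∃ R : ℝ, 0 < R ∧
      ∑ x : ZMod p, ZMod.stdAddChar ((n + 1 : ZMod p) * x ^ 2) = (-Complex.I) ^ n * R := by
    subst hn
    exact exists_sum_stdAddChar_sq n
  have h21 : (2 : ZMod p) * (n + 1) = 1 := by
    have : ((2 * n + 1 : ℕ) : ZMod p) = 0 := by rw [← hn]; exact ZMod.natCast_self _
    push_cast at this
    linear_combination this
  have hne : (n + 1 : ZMod p) ≠ 0 := right_ne_zero_of_mul (h21 ▸ one_ne_zero)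
  rw [sum_stdAddChar_mul_sq p h2 hne, ← hG] at hsum
  have hχ2 : complexQuadraticChar p 2 = (ZMod.χ₈ (p : ZMod 8) : ℂ) := by
    have h := complexQuadraticChar_intCast p 2
    rw [jacobiSym.at_two (hp.odd_of_ne_two h2)] at h
    exact_mod_cast h
  -- The frequency `n + 1` is `1/2`, so moving it to `1` costs the factor `χ(2)`.
  have hG1 : G = (ZMod.χ₈ (p : ZMod 8) : ℂ) * ((-Complex.I) ^ n * R) := by
    rw [← hsum, ← hχ2, ← mul_assoc, ← map_mul, h21, map_one, one_mul]
  have hnorm8 : ‖(ZMod.χ₈ (p : ZMod 8) : ℂ)‖ = 1 := by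
    rw [ZMod.χ₈_nat_eq_if_mod_eight, if_neg (by omega)]
    split_ifs <;> simp
  have hnormR : ‖G‖ = R := by
    rw [hG1, norm_mul, hnorm8, norm_mul, norm_pow, norm_neg, Complex.norm_I, one_pow,
      Complex.norm_of_nonneg hR.le, one_mul, one_mul]
  -- Taking norms in `G² = χ(-1) p` fixes the positive factor; the rest is a check of `p` modulo
  -- `8`.
  have hRp : R = Real.sqrt p := by
    have h1 : ‖complexQuadraticChar p (-1)‖ = 1 := by
      have h := complexQuadraticChar_intCast p (-1)
      push_cast at h
      rw [h, jacobiSym.at_neg_one (hp.odd_of_ne_two h2), ZMod.χ₄_nat_eq_if_mod_four,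
        if_neg (by omega)]
      split_ifs <;> simp
    have h3 := congrArg norm hsq
    rw [norm_pow, hnormR, norm_mul, h1, ZMod.card] at h3
    rw [eq_comm, Real.sqrt_eq_iff_mul_self_eq (by positivity) hR.le, ← pow_two, h3]
    simp
  rw [hG1, ← hRp, ← mul_assoc]
  congr 1
  rw [ZMod.χ₈_nat_eq_if_mod_eight, if_neg (by omega), epsSign]
  obtain ⟨t, ht⟩ : ∃ t, n = 4 * t + n % 4 := ⟨n / 4, by omega⟩
  have hI : (-Complex.I) ^ n = (-Complex.I) ^ (n % 4) := by
    conv_lhs => rw [ht, pow_add, pow_mul]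
    have : (-Complex.I) ^ 4 = 1 := by rw [Even.neg_pow (by decide), Complex.I_pow_four]
    rw [this, one_pow, one_mul]
  rw [hI]
  have hmod : n % 4 < 4 := Nat.mod_lt _ (by norm_num)
  have h3 : (-Complex.I) ^ 3 = Complex.I := by
    rw [Odd.neg_pow (by decide), Complex.I_pow_three, neg_neg]
  interval_cases h : n % 4
  · simp [show p % 8 = 1 by omega, show p % 4 = 1 by omega]
  · simp [show p % 8 = 3 by omega, show p % 4 = 3 by omega]
  · simp [show p % 8 = 5 by omega, show p % 4 = 1 by omega]
  · simp [show p % 8 = 7 by omega, show p % 4 = 3 by omega, h3]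

theorem sum_jacobiSym_mul_exp {p : ℕ} (hp : p.Prime) (h2 : p ≠ 2) {h : ℤ} (hh : ¬ (p : ℤ) ∣ h) :
    ∑ y ∈ Finset.range p, (jacobiSym y p : ℂ) *
      Complex.exp (2 * Real.pi * Complex.I * ((h : ℂ) * (y : ℂ) / (p : ℂ))) =
    (jacobiSym h p : ℂ) * (epsSign p * (Real.sqrt p : ℂ)) := by
  have : Fact p.Prime := ⟨hp⟩
  have hχ : (complexQuadraticChar p).IsQuadratic :=
    (quadraticChar_isQuadratic (ZMod p)).comp _
  have ha : (h : ZMod p) ≠ 0 := by rwa [Ne, ZMod.intCast_zmod_eq_zero_iff_dvd]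
  have h3 := gaussSum_mulShift_eq (complexQuadraticChar p) ZMod.stdAddChar (Units.mk0 _ ha)
  rw [hχ.inv, Units.val_mk0, gaussSum_complexQuadraticChar p h2,
    complexQuadraticChar_intCast] at h3
  rw [← h3, gaussSum, ← sum_range_zmod]
  refine Finset.sum_congr rfl fun y _ => ?_
  have h4 := complexQuadraticChar_intCast p y
  have h5 := ZMod.stdAddChar_coe (N := p) (h * y)
  rw [Int.cast_natCast] at h4
  rw [h4, AddChar.mulShift_apply]
  push_cast at h5
  rw [h5]
  congr 2
  ring

/-! ### Periodicity and vanishing of the half-integral weight sums. -/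

/-- The summand of `halfGaussSum m h (4 * c)`, written with the Jacobi symbol. -/
noncomputable def halfGaussTerm (m h : ℤ) (c d : ℕ) : ℂ :=
  epsSign d ^ (2 * m + 1) * (jacobiSym c d : ℂ) *
    Complex.exp (2 * Real.pi * Complex.I * ((h : ℂ) * (d : ℂ) / ((4 * c : ℕ) : ℂ)))

theorem epsSign_even {d : ℕ} (hd : Even d) : epsSign d = 0 := by
  have := Nat.even_iff.mp hd
  rw [epsSign, if_neg (by omega), if_neg (by omega)]

theorem epsSign_congr {d e : ℕ} (h : d % 4 = e % 4) : epsSign d = epsSign e := by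
  rw [epsSign, epsSign, h]

theorem halfGaussTerm_even (m h : ℤ) (c : ℕ) {d : ℕ} (hd : Even d) :
    halfGaussTerm m h c d = 0 := by
  rw [halfGaussTerm, epsSign_even hd, zero_zpow _ (by omega), zero_mul, zero_mul]

theorem halfGaussSum_four_mul (m h : ℤ) (c : ℕ) :
    halfGaussSum m h (4 * c) = ∑ d ∈ Finset.range (4 * c), halfGaussTerm m h c d := by
  refine Finset.sum_congr rfl fun d _ => ?_
  rcases Nat.even_or_odd d with hd | hd
  · rw [halfGaussTerm_even m h c hd, epsSign_even hd, zero_zpow _ (by omega), zero_mul, zero_mul]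
  · rw [halfGaussTerm, kroneckerSym_odd _ hd]
    push_cast
    rw [jacobiSym.mul_left, jacobiSym.at_four hd, one_mul]

theorem jacobiSym_add_right (a : ℕ) {d t : ℕ} (hd : Odd d) (h : 4 * a ∣ t) :
    jacobiSym a (d + t) = jacobiSym a d := by
  have ht : Even t := even_iff_two_dvd.mpr ((Dvd.intro _ (by ring : 2 * (2 * a) = 4 * a)).trans h)
  rw [jacobiSym.mod_right' a (hd.add_even ht), jacobiSym.mod_right' a hd]
  obtain ⟨s, rfl⟩ := h
  rw [Nat.add_mul_mod_self_left]

theorem halfGaussTerm_add (m h : ℤ) {c d t : ℕ} (ht : 4 ∣ t)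
    (hJ : Odd d → jacobiSym c (d + t) = jacobiSym c d) :
    halfGaussTerm m h c (d + t) = halfGaussTerm m h c d *
      Complex.exp (2 * Real.pi * Complex.I * ((h : ℂ) * (t : ℂ) / ((4 * c : ℕ) : ℂ))) := by
  rcases Nat.even_or_odd d with hd | hd
  · have he : Even t := even_iff_two_dvd.mpr ((by norm_num : 2 ∣ 4).trans ht)
    rw [halfGaussTerm_even m h c hd, halfGaussTerm_even m h c (hd.add he), zero_mul]
  · rw [halfGaussTerm, halfGaussTerm, hJ hd, epsSign_congr (by omega : (d + t) % 4 = d % 4),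
      mul_assoc (_ * _) (Complex.exp _), ← Complex.exp_add]
    congr 2
    push_cast
    ring

theorem exp_two_pi_I_mul_int (n : ℤ) : Complex.exp (2 * Real.pi * Complex.I * (n : ℂ)) = 1 := by
  rw [mul_comm]
  exact Complex.exp_int_mul_two_pi_mul_I n

theorem halfGaussTerm_periodic (m h : ℤ) {c : ℕ} (hc : c ≠ 0) :
    Function.Periodic (halfGaussTerm m h c) (4 * c) := by
  intro d
  rw [halfGaussTerm_add m h (dvd_mul_right 4 c) fun hd => jacobiSym_add_right c hd dvd_rfl,
    mul_div_assoc, div_self (by exact_mod_cast (by omega : 4 * c ≠ 0)), mul_one,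
    exp_two_pi_I_mul_int, mul_one]

theorem sum_range_add_of_periodic {F : ℕ → ℂ} {M : ℕ} (hF : Function.Periodic F M) (t : ℕ) :
    ∑ d ∈ Finset.range M, F (d + t) = ∑ d ∈ Finset.range M, F d := by
  induction t with
  | zero => simp
  | succ t ih =>
    have h1 := Finset.sum_range_succ (fun d => F (d + t)) M
    have h2 := Finset.sum_range_succ' (fun d => F (d + t)) M
    have h3 : F (M + t) = F (0 + t) := by rw [add_comm, hF, zero_add]
    rw [← ih]
    simp only [add_assoc, add_comm 1 t] at h1 h2 h3 ⊢
    rw [h1, h3] at h2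
    exact (add_right_cancel h2).symm

/-- The shift `d ↦ d + 4c/p^j` permutes the residues and preserves the symbol and `ε_d`, while it
multiplies the exponential by `e(h/p^j)`. A nonzero sum forces this constant to be `1`. -/
theorem halfGaussSum_eq_zero (m h : ℤ) {p j i r : ℕ} (hp : p ≠ 0) (hr : r ≠ 0)
    (hj : ¬ ((p ^ j : ℕ) : ℤ) ∣ h) : halfGaussSum m h (4 * (p ^ j * (p ^ (i + 1) * r))) = 0 := by
  set c := p ^ j * (p ^ (i + 1) * r) with hc
  set t := 4 * (p ^ (i + 1) * r) with ht
  have hc0 : c ≠ 0 := mul_ne_zero (pow_ne_zero _ hp) (mul_ne_zero (pow_ne_zero _ hp) hr)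
  have hJ : ∀ d, Odd d → jacobiSym c (d + t) = jacobiSym c d := by
    intro d hd
    -- The exponent `i + 1` keeps a factor `p` in the shift, so both `(p / ·)` and `(r / ·)` are
    -- invariant under it.
    have h1 : 4 * p ∣ t := mul_dvd_mul_left 4 (dvd_mul_of_dvd_left (dvd_pow_self p (by omega)) r)
    have h2 : 4 * r ∣ t := mul_dvd_mul_left 4 (dvd_mul_left r _)
    rw [hc]
    push_cast
    simp only [jacobiSym.mul_left, jacobiSym.pow_left, jacobiSym_add_right _ hd h1,
      jacobiSym_add_right _ hd h2]
  have hsum := sum_range_add_of_periodic (halfGaussTerm_periodic m h hc0) t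
  rw [Finset.sum_congr rfl fun d _ => halfGaussTerm_add m h (dvd_mul_right 4 _ : 4 ∣ t) (hJ d),
    ← Finset.sum_mul, ← halfGaussSum_four_mul] at hsum
  by_contra hne
  have hexp := mul_left_cancel₀ hne (hsum.trans (mul_one _).symm)
  rw [Complex.exp_eq_one_iff] at hexp
  obtain ⟨n, hn⟩ := hexp
  rw [mul_comm (n : ℂ)] at hn
  have h3 := mul_left_cancel₀ Complex.two_pi_I_ne_zero hn
  have ht0 : (t : ℂ) ≠ 0 := by
    exact_mod_cast mul_ne_zero four_ne_zero (mul_ne_zero (pow_ne_zero _ hp) hr)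
  have h4 : ((4 * c : ℕ) : ℂ) = ((p ^ j : ℕ) : ℂ) * (t : ℂ) := by
    rw [← Nat.cast_mul, ht, hc]
    congr 1
    ring
  rw [h4, mul_div_mul_right _ _ ht0, div_eq_iff (by exact_mod_cast pow_ne_zero _ hp)] at h3
  exact hj ⟨n, by rw [mul_comm]; exact_mod_cast h3⟩

/-! ### Twisted multiplicativity in the modulus. -/

/-- The Chinese remainder theorem for sums of periodic functions. -/
theorem sum_range_mul_of_periodic {F : ℕ → ℂ} {a b : ℕ} (ha : a ≠ 0) (hb : b ≠ 0)
    (hab : Nat.Coprime a b) (hF : Function.Periodic F (a * b)) :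
    ∑ d ∈ Finset.range (a * b), F d =
      ∑ x ∈ Finset.range a, ∑ y ∈ Finset.range b, F (x * b + y * a) := by
  rw [← Finset.sum_product', eq_comm]
  have hmaps : ∀ z ∈ Finset.range a ×ˢ Finset.range b,
      (z.1 * b + z.2 * a) % (a * b) ∈ Finset.range (a * b) := fun z _ =>
    Finset.mem_range.mpr (Nat.mod_lt _ (Nat.pos_of_ne_zero (mul_ne_zero ha hb)))
  have hinj : Set.InjOn (fun z : ℕ × ℕ => (z.1 * b + z.2 * a) % (a * b))
      (Finset.range a ×ˢ Finset.range b : Finset (ℕ × ℕ)) := by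
    rintro ⟨x, y⟩ hz ⟨x', y'⟩ hz' h
    simp only [Finset.coe_product, Set.mem_prod, Finset.mem_coe, Finset.mem_range] at hz hz'
    have h : x * b + y * a ≡ x' * b + y' * a [MOD a * b] := h
    have h1 : x * b ≡ x' * b [MOD a] := by
      have := h.of_dvd (dvd_mul_right a b)
      rwa [Nat.ModEq, Nat.add_mul_mod_self_right, Nat.add_mul_mod_self_right] at this
    have h2 : y * a ≡ y' * a [MOD b] := by
      have := h.of_dvd (dvd_mul_left b a)
      rwa [Nat.ModEq, add_comm, Nat.add_mul_mod_self_right, add_comm,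
        Nat.add_mul_mod_self_right] at this
    have h3 := Nat.ModEq.cancel_right_of_coprime hab h1
    have h4 := Nat.ModEq.cancel_right_of_coprime hab.symm h2
    rw [Nat.ModEq, Nat.mod_eq_of_lt hz.1, Nat.mod_eq_of_lt hz'.1] at h3
    rw [Nat.ModEq, Nat.mod_eq_of_lt hz.2, Nat.mod_eq_of_lt hz'.2] at h4
    rw [h3, h4]
  refine Finset.sum_nbij _ hmaps hinj
    (Finset.surjOn_of_injOn_of_card_le _ hmaps hinj (by simp)) fun z _ => ?_
  exact (hF.map_mod_nat _).symm

theorem I_zpow_two_mul_add_one (m : ℤ) :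
    Complex.I ^ (2 * m + 1) = ((Int.negOnePow m : ℤ) : ℂ) * Complex.I := by
  rw [zpow_add₀ Complex.I_ne_zero, zpow_mul, zpow_one]
  congr 1
  norm_cast
  rw [Complex.I_sq]
  rcases Int.even_or_odd m with hm | hm
  · rw [hm.neg_one_zpow, Int.negOnePow_even m hm]
    simp
  · rw [hm.neg_one_zpow, Int.negOnePow_odd m hm]
    simp

/-- The sign bookkeeping of reciprocity, checked on classes modulo `4`. This is where the twist
`(-1)^(k-1/2)` of the character arises. -/
theorem epsSign_zpow_mul_qrSign (m : ℤ) {x p d : ℕ} (hx : Odd x) (hp : Odd p)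
    (hd : d % 4 = (x * p) % 4) :
    epsSign d ^ (2 * m + 1) * (qrSign d p : ℂ) * epsSign p =
      epsSign x ^ (2 * m + 1) * (jacobiSym (Int.negOnePow m : ℤ) p : ℂ) := by
  have hd' : Odd d := by
    have := Nat.odd_iff.mp (hx.mul hp)
    exact Nat.odd_iff.mpr (by omega)
  have hI := I_zpow_two_mul_add_one m
  rw [qrSign.symm hd' hp, qrSign]
  have hp2 := Nat.odd_iff.mp hp
  have hx2 := Nat.odd_iff.mp hx
  rcases (by omega : p % 4 = 1 ∨ p % 4 = 3) with h | h
  · have hm : jacobiSym (Int.negOnePow m : ℤ) p = 1 := by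
      rcases Int.even_or_odd m with hm | hm
      · rw [Int.negOnePow_even m hm]
        simp
      · rw [Int.negOnePow_odd m hm, Units.val_neg, Units.val_one, jacobiSym.at_neg_one hp,
          ZMod.χ₄_nat_one_mod_four h]
    have hdx : d % 4 = x % 4 := by rw [hd, Nat.mul_mod, h, mul_one, Nat.mod_mod]
    rw [ZMod.χ₄_nat_one_mod_four h, jacobiSym.one_left, epsSign_congr hdx, hm,
      show epsSign p = 1 from if_pos h]
    simp
  · have hm : (jacobiSym (Int.negOnePow m : ℤ) p : ℂ) = ((Int.negOnePow m : ℤ) : ℂ) := by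
      rcases Int.even_or_odd m with hm | hm
      · rw [Int.negOnePow_even m hm]
        simp
      · rw [Int.negOnePow_odd m hm, Units.val_neg, Units.val_one, jacobiSym.at_neg_one hp,
          ZMod.χ₄_nat_three_mod_four h]
    have hdx : d % 4 = (x % 4 * 3) % 4 := by rw [hd, Nat.mul_mod, h]
    have hsq : ((Int.negOnePow m : ℤ) : ℂ) * ((Int.negOnePow m : ℤ) : ℂ) = 1 := by
      exact_mod_cast Int.units_coe_mul_self _
    have hep : epsSign p = Complex.I := by rw [epsSign, if_neg (by omega), if_pos h]
    rw [ZMod.χ₄_nat_three_mod_four h, jacobiSym.at_neg_one hd', hm, hep]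
    rcases (by omega : x % 4 = 1 ∨ x % 4 = 3) with h' | h' <;> rw [h'] at hdx
    · rw [show epsSign x = 1 by rw [epsSign, if_pos h'], show epsSign d = Complex.I by
        rw [epsSign, if_neg (by omega), if_pos (by omega)], hI, ZMod.χ₄_nat_three_mod_four (by omega)]
      push_cast
      rw [one_zpow]
      linear_combination (-((Int.negOnePow m : ℤ) : ℂ)) * Complex.I_sq
    · rw [show epsSign d = 1 by rw [epsSign, if_pos (by omega)], show epsSign x = Complex.I by
        rw [epsSign, if_neg (by omega), if_pos h'], hI, ZMod.χ₄_nat_one_mod_four (by omega)]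
      push_cast
      rw [one_zpow]
      linear_combination (-Complex.I) * hsq

/-- Writing `d = x * p + y * (4 * c)` separates the sum into `g_h(4c)` over `x` and an ordinary
quadratic Gauss sum modulo `p` over `y`. -/
theorem halfGaussSum_mul_prime (m h : ℤ) {c p : ℕ} (hc : c ≠ 0) (hp : p.Prime) (h2 : p ≠ 2)
    (hpc : ¬ p ∣ c) (hph : ¬ (p : ℤ) ∣ h) :
    halfGaussSum m h (4 * (c * p)) =
      halfGaussSum m h (4 * c) * ((jacobiSym (twistedInt m h) p : ℂ) * (Real.sqrt p : ℂ)) := by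
  have hodd := hp.odd_of_ne_two h2
  have hcop : Nat.Coprime p (4 * c) :=
    (hp.coprime_iff_not_dvd).mpr fun hd => by
      rcases hp.dvd_mul.mp hd with hd | hd
      · exact h2 ((Nat.prime_dvd_prime_iff_eq hp Nat.prime_two).mp
          (hp.dvd_of_dvd_pow (show p ∣ 2 ^ 2 from hd)))
      · exact hpc hd
  have hcJ : jacobiSym c p * jacobiSym c p = 1 := by
    rw [← pow_two]
    exact jacobiSym.sq_one (by
      rw [Int.gcd_natCast_natCast]
      exact (hp.coprime_iff_not_dvd.mpr hpc).symm)
  have hper := halfGaussTerm_periodic m h (mul_ne_zero hc hp.ne_zero)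
  rw [← mul_assoc] at hper
  have hp0 : (p : ℂ) ≠ 0 := by exact_mod_cast hp.ne_zero
  have hc0 : (c : ℂ) ≠ 0 := by exact_mod_cast hc
  -- The factor `epsSign p` lets the signs be absorbed; it cancels later against the `ε_p` in the
  -- value of the Gauss sum over `y`.
  have key : ∀ x y : ℕ, epsSign p * halfGaussTerm m h (c * p) (x * p + y * (4 * c)) =
      (jacobiSym (Int.negOnePow m : ℤ) p : ℂ) * (halfGaussTerm m h c x *
      ((jacobiSym y p : ℂ) *
        Complex.exp (2 * Real.pi * Complex.I * ((h : ℂ) * (y : ℂ) / (p : ℂ))))) := by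
    intro x y
    have h4y : Even (y * (4 * c)) := even_iff_two_dvd.mpr ⟨y * (2 * c), by ring⟩
    rcases Nat.even_or_odd x with hx | hx
    · rw [halfGaussTerm_even m h c hx, halfGaussTerm_even m h _ ((hx.mul_right p).add h4y)]
      simp
    · have hd : Odd (x * p + y * (4 * c)) := (hx.mul hodd).add_even h4y
      have h1 : jacobiSym (c * p : ℕ) (x * p + y * (4 * c)) =
          jacobiSym c x * (qrSign (x * p + y * (4 * c)) p * jacobiSym y p) := by
        have : NeZero x := ⟨hx.pos.ne'⟩
        have : NeZero p := ⟨hp.ne_zero⟩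
        have h3 : jacobiSym ((x * p + y * (4 * c) : ℕ) : ℤ) p = jacobiSym c p * jacobiSym y p := by
          rw [jacobiSym.mod_left' (a₂ := (y * (4 * c) : ℤ)) (by push_cast; simp),
            jacobiSym.mul_left, jacobiSym.mul_left, jacobiSym.at_four hodd]
          ring
        rw [Nat.cast_mul, jacobiSym.mul_left,
          jacobiSym_add_right c (hx.mul hodd) (dvd_mul_left _ _), jacobiSym.mul_right,
          jacobiSym.quadratic_reciprocity' hodd hd, h3]
        -- `(c/p)` occurs twice, once from `(c/d)` and once from `(d/p)`, and squares to `1`.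
        linear_combination jacobiSym c x * qrSign (x * p + y * (4 * c)) p * jacobiSym y p * hcJ
      have h3 := epsSign_zpow_mul_qrSign m hx hodd
        (show (x * p + y * (4 * c)) % 4 = (x * p) % 4 by
          rw [show y * (4 * c) = 4 * (y * c) by ring, Nat.add_mul_mod_self_left])
      have h4 : Complex.exp (2 * Real.pi * Complex.I *
          ((h : ℂ) * ((x * p + y * (4 * c) : ℕ) : ℂ) / ((4 * (c * p) : ℕ) : ℂ))) =
          Complex.exp (2 * Real.pi * Complex.I * ((h : ℂ) * (x : ℂ) / ((4 * c : ℕ) : ℂ))) *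
          Complex.exp (2 * Real.pi * Complex.I * ((h : ℂ) * (y : ℂ) / (p : ℂ))) := by
        rw [← Complex.exp_add]
        congr 1
        push_cast
        field_simp
      rw [halfGaussTerm, halfGaussTerm, h1, h4]
      push_cast
      linear_combination (jacobiSym c x : ℂ) * (jacobiSym y p : ℂ) *
        Complex.exp (2 * Real.pi * Complex.I * ((h : ℂ) * (x : ℂ) / (4 * (c : ℂ)))) *
        Complex.exp (2 * Real.pi * Complex.I * ((h : ℂ) * (y : ℂ) / (p : ℂ))) * h3
  have heps : epsSign p ≠ 0 := by
    have := Nat.odd_iff.mp hodd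
    rw [epsSign]
    rcases (by omega : p % 4 = 1 ∨ p % 4 = 3) with h | h <;> simp [h]
  apply mul_left_cancel₀ heps
  rw [halfGaussSum_four_mul, ← mul_assoc 4, sum_range_mul_of_periodic (by omega) hp.ne_zero
    hcop.symm hper]
  simp only [Finset.mul_sum]
  simp only [key]
  simp only [← Finset.mul_sum]
  rw [sum_jacobiSym_mul_exp hp h2 hph, ← Finset.sum_mul, ← halfGaussSum_four_mul, twistedInt,
    jacobiSym.mul_left]
  push_cast
  ring

/-- Primes are split off one at a time. The modulus `c` is generalized since the part of `n` still
to be treated is moved into it. -/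
theorem halfGaussSum_mul_squarefree (m h : ℤ) {c n : ℕ} (hc : c ≠ 0) (hn : Squarefree n)
    (hnc : Nat.Coprime n c) (hnh : Nat.Coprime n (2 * h.natAbs)) :
    halfGaussSum m h (4 * (c * n)) =
      halfGaussSum m h (4 * c) * ((jacobiSym (twistedInt m h) n : ℂ) * (Real.sqrt n : ℂ)) := by
  induction n using Nat.recOnMul generalizing c with
  | zero => exact absurd hn not_squarefree_zero
  | one => simp
  | prime p hp =>
    have h2 := hnh.coprime_mul_right_right
    refine halfGaussSum_mul_prime m h hc hp ?_ (hp.coprime_iff_not_dvd.mp hnc) ?_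
    · rintro rfl
      simp at h2
    · rw [Int.natCast_dvd]
      exact hp.coprime_iff_not_dvd.mp hnh.coprime_mul_left_right
  | mul a b iha ihb =>
    have hab := Nat.squarefree_mul_iff.mp hn
    have : NeZero a := ⟨hab.2.1.ne_zero⟩
    have : NeZero b := ⟨hab.2.2.ne_zero⟩
    rw [← mul_assoc c, ihb (mul_ne_zero hc hab.2.1.ne_zero) hab.2.2
      (hnc.coprime_mul_left.mul_right hab.1.symm) hnh.coprime_mul_left,
      iha hc hab.2.1 hnc.coprime_mul_right hnh.coprime_mul_right, jacobiSym.mul_right,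
      Nat.cast_mul, Real.sqrt_mul (Nat.cast_nonneg a)]
    push_cast
    ring

/-! ### The Dirichlet series over squarefree integers, and the characters involved. -/

/-- Compare Euler factors: `1 + z = (1 - z²) / (1 - z)` with `z = χ(p) p^(-s)`, where `χ²` is
trivial. -/
theorem hasSum_squarefree {N : ℕ} [NeZero N] {χ : DirichletCharacter ℂ N} (hχ : χ ^ 2 = 1) {s : ℂ}
    (hs : 1 < s.re) :
    HasSum (fun n : ℕ => if Squarefree n then χ n * (n : ℂ) ^ (-s) else 0)
      (χ.LFunction s / DirichletCharacter.LFunctionTrivChar N (2 * s)) := by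
  have hs0 : s ≠ 0 := fun h0 => by rw [h0] at hs; norm_num at hs
  have hs2 : 1 < (2 * s).re := by
    rw [Complex.mul_re]
    norm_num
    linarith
  set f : ℕ → ℂ := fun n => if Squarefree n then χ n * (n : ℂ) ^ (-s) else 0 with hf
  have hsum : Summable (‖f ·‖) := by
    refine (summable_dirichletSummand χ hs).of_nonneg_of_le (fun n => norm_nonneg _) fun n => ?_
    rw [hf]
    dsimp only
    split_ifs
    · exact le_rfl
    · simp
  have hf1 : f 1 = 1 := by simp [hf]
  have hf0 : f 0 = 0 := by simp [hf]
  have hmul : ∀ {m n : ℕ}, m.Coprime n → f (m * n) = f m * f n := by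
    intro m n hmn
    simp only [hf, Nat.squarefree_mul hmn]
    by_cases hm : Squarefree m <;> by_cases hn : Squarefree n <;> simp [hm, hn]
    rw [Complex.natCast_mul_natCast_cpow]
    ring
  have hprod := EulerProduct.eulerProduct_hasProd hf1 hmul hsum hf0
  have hpow : ∀ p : Nat.Primes, ∑' e, f ((p : ℕ) ^ e) = 1 + χ p * (p : ℂ) ^ (-s) := by
    intro p
    rw [tsum_eq_sum (s := Finset.range 2)]
    · simp [Finset.sum_range_succ, hf, p.2.prime.squarefree]
    · intro e he
      have he := Finset.mem_range.not.mp he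
      have : ¬ Squarefree ((p : ℕ) ^ e) := fun h => by
        have := (Nat.squarefree_pow_iff p.2.ne_one (by omega)).mp h
        omega
      simp [hf, this]
  simp only [hpow] at hprod
  have h1 := DirichletCharacter.LSeries_eulerProduct_hasProd χ hs
  have h2 := DirichletCharacter.LSeries_eulerProduct_hasProd (1 : DirichletCharacter ℂ N) hs2
  rw [← DirichletCharacter.LFunction_eq_LSeries _ hs] at h1
  rw [← DirichletCharacter.LFunction_eq_LSeries _ hs2] at h2
  have h3 : HasProd (fun p : Nat.Primes => (1 - χ p * (p : ℂ) ^ (-s))⁻¹)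
      ((∑' n, f n) * DirichletCharacter.LFunctionTrivChar N (2 * s)) := by
    convert! hprod.mul h2 using 2 with p
    have hχp : (1 : DirichletCharacter ℂ N) p = χ p * χ p := by
      rw [← hχ, MulChar.pow_apply' _ two_ne_zero, pow_two]
    have hpow2 : (p : ℂ) ^ (-(2 * s)) = (p : ℂ) ^ (-s) * (p : ℂ) ^ (-s) := by
      rw [← Complex.cpow_add _ _ (by exact_mod_cast p.2.ne_zero)]
      congr 1
      ring
    have hlt : ‖χ p * (p : ℂ) ^ (-s)‖ < 1 := by
      rw [norm_mul]
      refine (mul_le_of_le_one_left (norm_nonneg _) (χ.norm_le_one _)).trans_lt ?_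
      exact (Complex.norm_prime_cpow_le_one_half p hs).trans_lt (by norm_num)
    have hm : 1 - χ p * (p : ℂ) ^ (-s) ≠ 0 := fun h0 => by
      rw [← sub_eq_zero.mp h0, norm_one] at hlt
      exact lt_irrefl _ hlt
    have hp : 1 + χ p * (p : ℂ) ^ (-s) ≠ 0 := fun h0 => by
      rw [← norm_neg, ← eq_neg_of_add_eq_zero_left h0, norm_one] at hlt
      exact lt_irrefl _ hlt
    rw [hχp, hpow2, show 1 - χ p * χ p * ((p : ℂ) ^ (-s) * (p : ℂ) ^ (-s)) =
      (1 - χ p * (p : ℂ) ^ (-s)) * (1 + χ p * (p : ℂ) ^ (-s)) by ring]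
    field_simp
  have hne : DirichletCharacter.LFunctionTrivChar N (2 * s) ≠ 0 :=
    DirichletCharacter.LFunction_ne_zero_of_one_le_re _ (.inr fun h => by
      rw [h, Complex.one_re] at hs2; exact lt_irrefl _ hs2) hs2.le
  rw [h1.unique h3, mul_div_cancel_right₀ _ hne]
  exact hsum.of_norm.hasSum

theorem quadraticSymbolChar_natCast (a : ℤ) [NeZero a] {n : ℕ} (hn : Nat.Coprime n (4 * a.natAbs)) :
    quadraticSymbolChar a (n : ZMod (4 * a.natAbs)) = (jacobiSym a n : ℂ) := by
  have hodd : Odd n := Nat.coprime_two_right.mp (hn.coprime_dvd_right ⟨2 * a.natAbs, by ring⟩)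
  have hu := (ZMod.isUnit_iff_coprime n (4 * a.natAbs)).mpr hn
  change (if IsUnit (n : ZMod (4 * a.natAbs)) then (kroneckerSym a (n : ZMod (4 * a.natAbs)).val : ℂ)
    else 0) = _
  rw [if_pos hu, ZMod.val_natCast, kroneckerSym_odd a (hodd.mod_even ⟨2 * a.natAbs, by ring⟩),
    ← jacobiSym.mod_right a hodd]

theorem quadraticSymbolChar_sq (a : ℤ) [NeZero a] : quadraticSymbolChar a ^ 2 = 1 := by
  ext x
  obtain ⟨n, hn⟩ : ∃ n : ℕ, (n : ZMod (4 * a.natAbs)) = x :=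
    ⟨(x : ZMod (4 * a.natAbs)).val, ZMod.natCast_zmod_val _⟩
  have hcop := (ZMod.isUnit_iff_coprime n (4 * a.natAbs)).mp (hn ▸ x.isUnit)
  rw [MulChar.pow_apply' _ two_ne_zero, MulChar.one_apply_coe, ← hn,
    quadraticSymbolChar_natCast a hcop]
  exact_mod_cast jacobiSym.sq_one (hcop.symm.coprime_dvd_left (dvd_mul_left _ 4))

theorem primeFactors_four_mul (n : ℕ) : (4 * n).primeFactors = (2 * n).primeFactors := by
  rcases eq_or_ne n 0 with rfl | hn
  · rfl
  · rw [Nat.primeFactors_mul four_ne_zero hn, Nat.primeFactors_mul two_ne_zero hn,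
      show 4 = 2 ^ 2 by rfl, Nat.primeFactors_prime_pow two_ne_zero Nat.prime_two,
      Nat.prime_two.primeFactors]

theorem LFunctionTrivChar_four_mul (n : ℕ) [NeZero (4 * n)] {s : ℂ} (hs : s ≠ 1) :
    DirichletCharacter.LFunctionTrivChar (4 * n) s = partialZeta (2 * n) s := by
  rw [DirichletCharacter.LFunctionTrivChar_eq_mul_riemannZeta hs, partialZeta, mul_comm,
    primeFactors_four_mul]

theorem partialLFunction_of_dvd {N Q : ℕ} [NeZero N] (χ : DirichletCharacter ℂ N) (s : ℂ)
    (hQ : ∀ p ∈ Q.primeFactors, p ∣ N) : partialLFunction Q χ s = χ.LFunction s := by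
  rw [partialLFunction, Finset.prod_eq_one, mul_one]
  intro p hp
  have hpp := Nat.prime_of_mem_primeFactors hp
  rw [χ.map_nonunit, zero_mul, sub_zero]
  rw [ZMod.isUnit_prime_iff_not_dvd hpp]
  exact not_not.mpr (hQ p hp)

/-! ### Finite Dirichlet polynomials. -/

theorem exists_dirichletPolynomial_eq_sum {ι : Type*} [Fintype ι] (f : ι → ℂ) (n : ι → ℕ+) :
    ∃ a : ℕ+ →₀ ℂ, ∀ s : ℂ,
      dirichletPolynomial a s = ∑ i, f i * ((n i : ℕ) : ℂ) ^ (-s) := by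
  refine ⟨∑ i, Finsupp.single (n i) (f i), fun s => ?_⟩
  rw [dirichletPolynomial, ← Finsupp.sum_finsetSum_index (by simp) (by intros; ring)]
  exact Finset.sum_congr rfl fun i _ => Finsupp.sum_single_index (by simp)

theorem exists_dirichletPolynomial_mul_linear (a : ℕ+ →₀ ℂ) (q : ℕ+) (z : ℂ) :
    ∃ b : ℕ+ →₀ ℂ, ∀ s : ℂ,
      dirichletPolynomial b s = dirichletPolynomial a s * (1 - z * ((q : ℕ) : ℂ) ^ (-s)) := by
  obtain ⟨b, hb⟩ := exists_dirichletPolynomial_eq_sum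
    (Sum.elim (fun n : a.support => a n) (fun n : a.support => -(z * a n)))
    (Sum.elim (fun n : a.support => (n : ℕ+)) (fun n : a.support => q * n))
  refine ⟨b, fun s => ?_⟩
  have ha : dirichletPolynomial a s = ∑ n : a.support, a n * (((n : ℕ+) : ℕ) : ℂ) ^ (-s) :=
    (Finset.sum_coe_sort a.support fun n : ℕ+ => a n * ((n : ℕ) : ℂ) ^ (-s)).symm
  rw [hb, Fintype.sum_sum_type, ha, mul_sub, mul_one, Finset.sum_mul, sub_eq_add_neg,
    ← Finset.sum_neg_distrib]
  congr 1
  refine Finset.sum_congr rfl fun n _ => ?_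
  simp only [Sum.elim_inr, PNat.mul_coe, Nat.cast_mul, Complex.natCast_mul_natCast_cpow]
  ring

theorem exists_dirichletPolynomial_mul_prod (a : ℕ+ →₀ ℂ) (S : Finset ℕ) (hS : ∀ p ∈ S, 0 < p)
    (z : ℕ → ℂ) :
    ∃ b : ℕ+ →₀ ℂ, ∀ s : ℂ, dirichletPolynomial b s =
      dirichletPolynomial a s * ∏ p ∈ S, (1 - z p * (p : ℂ) ^ (-s)) := by
  induction S using Finset.induction_on with
  | empty => exact ⟨a, by simp⟩
  | insert p S hp ih =>
    obtain ⟨b, hb⟩ := ih fun q hq => hS q (Finset.mem_insert_of_mem hq)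
    obtain ⟨b', hb'⟩ := exists_dirichletPolynomial_mul_linear b
      ⟨p, hS p (Finset.mem_insert_self p S)⟩ (z p)
    refine ⟨b', fun s => ?_⟩
    rw [hb', hb, Finset.prod_insert hp, PNat.mk_coe]
    ring

/-! ### The moduli that contribute, and the final summation. -/

theorem pow_dvd_of_halfGaussSum_ne_zero {m h : ℤ} {c p j : ℕ} (hc : c ≠ 0)
    (hg : halfGaussSum m h (4 * c) ≠ 0) (hpj : p ^ (j + 1) ∣ c) : p ^ j ∣ h.natAbs := by
  by_contra hj
  obtain ⟨r, rfl⟩ := hpj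
  have hp : p ≠ 0 := fun h0 => hc (by simp [h0])
  refine hg ?_
  rw [show p ^ (j + 1) * r = p ^ j * (p ^ (0 + 1) * r) by ring]
  exact halfGaussSum_eq_zero m h hp (right_ne_zero_of_mul hc) (by rwa [Int.natCast_dvd])

/-- Take `u = gcd(c, 2h²)`. If `p` divides both `n = c/u` and `2h`, and `p^v` exactly divides `u`,
then `p^(v+1) ∣ c`, so `p^v ∣ h`. This makes `p^(v+1)` divide `2h²`, hence `u`, a contradiction. -/
theorem exists_eq_mul_of_halfGaussSum_ne_zero {m h : ℤ} (hh : h ≠ 0) {c : ℕ} (hc : c ≠ 0)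
    (hg : halfGaussSum m h (4 * c) ≠ 0) :
    ∃ u ∈ (2 * h.natAbs ^ 2).divisors, ∃ n, c = u * n ∧ Squarefree n ∧
      Nat.Coprime n (2 * h.natAbs) := by
  have hD : 2 * h.natAbs ^ 2 ≠ 0 := mul_ne_zero two_ne_zero (pow_ne_zero 2 (Int.natAbs_ne_zero.mpr hh))
  obtain ⟨n, hn⟩ := Nat.gcd_dvd_left c (2 * h.natAbs ^ 2)
  have hu0 : Nat.gcd c (2 * h.natAbs ^ 2) ≠ 0 := Nat.gcd_ne_zero_left hc
  have hcop : Nat.Coprime n (2 * h.natAbs) := by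
    refine Nat.coprime_of_dvd fun p hp hpn hph => ?_
    obtain ⟨v, u', hu', hu⟩ := Nat.exists_eq_pow_mul_and_not_dvd hu0 p hp.ne_one
    have h1 : p ^ (v + 1) ∣ c := by
      rw [hn, pow_succ]
      exact mul_dvd_mul (hu ▸ dvd_mul_right _ _) hpn
    have h2 := pow_dvd_of_halfGaussSum_ne_zero hc hg h1
    have h3 : p ^ (v + 1) ∣ 2 * h.natAbs ^ 2 := by
      -- For `v = 0` use `p ∣ 2h`; for `v ≥ 1`, `p^v ∣ h` also gives `p ∣ h`, so `p^(v+1) ∣ h²`.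
      rcases Nat.eq_zero_or_pos v with rfl | hv
      · rw [zero_add, pow_one]
        exact hph.trans ⟨h.natAbs, by ring⟩
      · refine dvd_mul_of_dvd_right ?_ 2
        rw [pow_succ, pow_two]
        exact mul_dvd_mul h2 ((dvd_pow_self p hv.ne').trans h2)
    have h4 := Nat.dvd_gcd h1 h3
    rw [hu, pow_succ] at h4
    exact hu' (Nat.dvd_of_mul_dvd_mul_left (pow_pos hp.pos v) h4)
  refine ⟨_, Nat.mem_divisors.mpr ⟨Nat.gcd_dvd_right c _, hD⟩, n, hn, ?_, hcop⟩
  rw [Nat.squarefree_iff_prime_squarefree]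
  intro p hp hpn
  have h1 : p ^ (1 + 1) ∣ c := by
    rw [hn, pow_two]
    exact dvd_mul_of_dvd_right hpn _
  have h2 := pow_dvd_of_halfGaussSum_ne_zero hc hg h1
  rw [pow_one] at h2
  exact hp.one_lt.ne' (Nat.eq_one_of_dvd_coprimes hcop ((dvd_mul_right p p).trans hpn) (h2.mul_left 2))

theorem exists_hasSum_halfGaussSum (m h : ℤ) [NeZero h] :
    ∃ a : ℕ+ →₀ ℂ, ∀ w : ℂ, 3 / 4 < w.re →
      HasSum (fun c : ℕ+ => halfGaussSum m h (4 * (c : ℕ)) / ((4 * (c : ℕ) : ℕ) : ℂ) ^ (2 * w))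
        ((chiSymbol m h).LFunction (2 * w - 1 / 2) / partialZeta (2 * h.natAbs) (4 * w - 1) *
          dirichletPolynomial a (2 * w)) := by
  set D := 2 * h.natAbs ^ 2 with hD
  have hpos (u : D.divisors) : 0 < (u : ℕ) := Nat.pos_of_mem_divisors u.2
  obtain ⟨a, ha⟩ := exists_dirichletPolynomial_eq_sum
    (fun u : D.divisors => halfGaussSum m h (4 * (u : ℕ)))
    (fun u => ⟨4 * (u : ℕ), by have := hpos u; omega⟩)
  refine ⟨a, fun w hw => ?_⟩
  have hN := natAbs_twistedInt m h
  have hs : 1 < (2 * w - 1 / 2 : ℂ).re := by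
    rw [Complex.sub_re, Complex.mul_re]
    norm_num
    linarith
  have hs1 : 2 * (2 * w - 1 / 2) = 4 * w - 1 := by ring
  have hs2 : 4 * w - 1 ≠ 1 := fun h0 => by
    have := congrArg Complex.re h0
    rw [Complex.sub_re, Complex.mul_re] at this
    norm_num at this
    linarith
  have hb := hasSum_squarefree (quadraticSymbolChar_sq (twistedInt m h)) hs
  have hζ : DirichletCharacter.LFunctionTrivChar (4 * (twistedInt m h).natAbs) (4 * w - 1) =
      partialZeta (2 * h.natAbs) (4 * w - 1) := by
    rw [LFunctionTrivChar_four_mul _ hs2, hN]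
  rw [hs1, hζ] at hb
  set b : ℕ → ℂ := fun n => if Squarefree n then
    quadraticSymbolChar (twistedInt m h) n * (n : ℂ) ^ (-(2 * w - 1 / 2)) else 0 with hbdef
  set A : D.divisors → ℂ := fun u =>
    halfGaussSum m h (4 * (u : ℕ)) * ((4 * (u : ℕ) : ℕ) : ℂ) ^ (-(2 * w)) with hA
  have hbsupp : ∀ n, b n ≠ 0 → Squarefree n ∧ Nat.Coprime n (2 * h.natAbs) := by
    intro n hn
    simp only [hbdef, ne_eq, ite_eq_right_iff, Classical.not_imp, mul_eq_zero, not_or] at hn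
    refine ⟨hn.1, ?_⟩
    have hu := (ZMod.isUnit_iff_coprime n _).mp (not_not.mp (mt (MulChar.map_nonunit _) hn.2.1))
    rw [hN] at hu
    exact hu.coprime_dvd_right ⟨2, by ring⟩
  have hbval : ∀ n, Squarefree n → Nat.Coprime n (2 * h.natAbs) →
      b n = (jacobiSym (twistedInt m h) n : ℂ) * (Real.sqrt n : ℂ) * (n : ℂ) ^ (-(2 * w)) := by
    intro n hn hcop
    have hcop4 : Nat.Coprime n (4 * (twistedInt m h).natAbs) := by
      rw [hN, show 4 * h.natAbs = 2 * (2 * h.natAbs) by ring]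
      exact hcop.coprime_mul_right_right.mul_right hcop
    rw [hbdef]
    dsimp only
    rw [if_pos hn, quadraticSymbolChar_natCast _ hcop4, mul_assoc, Real.sqrt_eq_rpow,
      Complex.ofReal_cpow (Nat.cast_nonneg n), Complex.ofReal_natCast,
      ← Complex.cpow_add _ _ (by exact_mod_cast hn.ne_zero)]
    congr 2
    push_cast
    ring
  have hterm : ∀ (u : D.divisors) (n : ℕ), Squarefree n → Nat.Coprime n (2 * h.natAbs) →
      halfGaussSum m h (4 * (u * n)) / ((4 * (u * n) : ℕ) : ℂ) ^ (2 * w) = A u * b n := by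
    intro u n hn hcop
    have hnD : Nat.Coprime n D := by
      rw [hD, show 2 * h.natAbs ^ 2 = (2 * h.natAbs) * h.natAbs by ring]
      exact hcop.mul_right hcop.coprime_mul_left_right
    rw [halfGaussSum_mul_squarefree m h (hpos u).ne' hn
      (hnD.coprime_dvd_right (Nat.dvd_of_mem_divisors u.2)) hcop, hbval n hn hcop, ← mul_assoc 4,
      Nat.cast_mul (4 * (u : ℕ)), Complex.natCast_mul_natCast_cpow, hA]
    simp only [Complex.cpow_neg]
    ring
  have hAb : HasSum (fun z : D.divisors × ℕ => A z.1 * b z.2)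
      ((∑ u, A u) * ((chiSymbol m h).LFunction (2 * w - 1 / 2) /
        partialZeta (2 * h.natAbs) (4 * w - 1))) :=
    (hasSum_fintype A).mul hb
      (summable_mul_of_summable_norm (hasSum_fintype _).summable hb.summable.norm)
  rw [ha, mul_comm (_ / _)]
  have hmem : ∀ z : Function.support fun z : D.divisors × ℕ => A z.1 * b z.2,
      Squarefree z.1.2 ∧ Nat.Coprime z.1.2 (2 * h.natAbs) := fun z =>
    hbsupp _ (right_ne_zero_of_mul z.2)
  -- The series over `c` is reindexed by `(u, n) ↦ u * n` on supports; it is injective since `u =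
  -- gcd(u * n, 2h²)`.
  refine (hasSum_iff_hasSum_of_ne_zero_bij
    (fun z => ⟨z.1.1 * z.1.2, Nat.mul_pos (hpos _) (hmem z).1.ne_zero.bot_lt⟩)
    ?_ ?_ ?_).mpr hAb
  · rintro ⟨⟨u, n⟩, hz⟩ ⟨⟨u', n'⟩, hz'⟩ he
    have he : (u : ℕ) * n = u' * n' := congrArg PNat.val he
    have hgcd : ∀ (v : D.divisors) (k : ℕ), Nat.Coprime k (2 * h.natAbs) →
        Nat.gcd (v * k) D = v := by
      intro v k hk
      have hkD : Nat.Coprime k D := by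
        rw [hD, show 2 * h.natAbs ^ 2 = (2 * h.natAbs) * h.natAbs by ring]
        exact hk.mul_right hk.coprime_mul_left_right
      rw [Nat.Coprime.gcd_mul_right_cancel _ hkD]
      exact Nat.gcd_eq_left (Nat.dvd_of_mem_divisors v.2)
    have hu : (u : ℕ) = u' := by
      rw [← hgcd u n (hmem ⟨_, hz⟩).2, ← hgcd u' n' (hmem ⟨_, hz'⟩).2, he]
    have hn : n = n' := by
      rw [← hu] at he
      exact Nat.eq_of_mul_eq_mul_left (hpos u) he
    simp only [Subtype.mk.injEq, Prod.mk.injEq]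
    exact ⟨Subtype.ext hu, hn⟩
  · intro c hc
    have hg : halfGaussSum m h (4 * (c : ℕ)) ≠ 0 := fun h0 => hc (by simp [h0])
    obtain ⟨u, hu, n, hcn, hsq, hcop⟩ :=
      exists_eq_mul_of_halfGaussSum_ne_zero (NeZero.ne h) c.ne_zero hg
    refine ⟨⟨(⟨u, hu⟩, n), ?_⟩, PNat.eq hcn.symm⟩
    rw [Function.mem_support, ← hterm ⟨u, hu⟩ n hsq hcop, ← hcn]
    exact hc
  · intro z
    exact hterm _ _ (hmem z).1 (hmem z).2

theorem mainTheorem9 (m h : ℤ) [NeZero h] :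
    (∃ a : ℕ+ →₀ ℂ, ∀ w : ℂ, 3 / 4 < w.re →
      HasSum (fun c : ℕ+ => halfGaussSum m h (4 * (c : ℕ)) / ((4 * (c : ℕ) : ℕ) : ℂ) ^ (2 * w))
        (partialLFunction 2 (chiSymbol m h) (2 * w - 1 / 2) /
            partialZeta (2 * h.natAbs) (4 * w - 1) *
          dirichletPolynomial a (2 * w))) ∧
    (∃ a : ℕ+ →₀ ℂ, ∀ w : ℂ, 3 / 4 < w.re →
      HasSum (fun c : ℕ+ => halfGaussSum m h (4 * (c : ℕ)) / ((4 * (c : ℕ) : ℕ) : ℂ) ^ (2 * w))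
        (partialLFunction 2 (chiField m h) (2 * w - 1 / 2) /
            partialZeta (2 * h.natAbs) (4 * w - 1) *
          dirichletPolynomial a (2 * w))) := by
  obtain ⟨a, ha⟩ := exists_hasSum_halfGaussSum m h
  refine ⟨⟨a, fun w hw => ?_⟩, ?_⟩
  · rw [partialLFunction_of_dvd]
    · exact ha w hw
    · intro p hp
      exact (Nat.dvd_of_mem_primeFactors hp).trans ⟨2 * (twistedInt m h).natAbs, by ring⟩
  · set N := 4 * (twistedInt m h).natAbs with hN
    -- The Euler factors separating the two characters are absorbed. The prime `2` is already
    -- removed on both sides, and `p^(1/2)` comes from `p^(-(2w - 1/2))`.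
    obtain ⟨b, hb⟩ := exists_dirichletPolynomial_mul_prod a (N.primeFactors \ {2})
      (fun p hp => (Nat.prime_of_mem_primeFactors (Finset.mem_sdiff.mp hp).1).pos)
      fun p => chiField m h p * (p : ℂ) ^ (1 / 2 : ℂ)
    refine ⟨b, fun w hw => ?_⟩
    have hs : 2 * w - 1 / 2 ≠ 1 := fun h0 => by
      have := congrArg Complex.re h0
      rw [Complex.sub_re, Complex.mul_re] at this
      norm_num at this
      linarith
    have hL : (chiSymbol m h).LFunction (2 * w - 1 / 2) =
        partialLFunction 2 (chiField m h) (2 * w - 1 / 2) * ∏ p ∈ N.primeFactors \ {2},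
          (1 - chiField m h p * (p : ℂ) ^ (1 / 2 : ℂ) * (p : ℂ) ^ (-(2 * w))) := by
      have h1 := DirichletCharacter.LFunction_changeLevel (chiSymbol m h).conductor_dvd_level
        (chiSymbol m h).primitiveCharacter (.inr hs)
      rw [DirichletCharacter.changeLevel_primitiveCharacter] at h1
      have h2 : 2 ∈ N.primeFactors := Nat.mem_primeFactors.mpr
        ⟨Nat.prime_two, ⟨2 * (twistedInt m h).natAbs, by ring⟩, NeZero.ne N⟩
      rw [h1, partialLFunction, Nat.prime_two.primeFactors, mul_assoc,
        ← Finset.prod_sdiff (Finset.singleton_subset_iff.mpr h2), mul_comm (∏ p ∈ _ \ _, _)]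
      congr 2
      refine Finset.prod_congr rfl fun p hp => ?_
      have hp0 := (Nat.prime_of_mem_primeFactors (Finset.mem_sdiff.mp hp).1).ne_zero
      rw [mul_assoc, ← Complex.cpow_add _ _ (by exact_mod_cast hp0)]
      congr 3
      ring
    convert! ha w hw using 1
    rw [hL, hb]
    ring
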